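/- Proposition 2.5. Let $D$ be an integral domain with quotient field $K$, and let $G$ be a torsion-free abelian group (written additively) satisfying the ascending chain condition on cyclic subgroups. Let $D[G]$ and $K[G]$ be the group algebras of $G$ over $D$ and $K$ (these are domains). For a domain $R$, let $\mathfrak X(R)$ be the set of prime ideals of $R$ of height one; $R$ is called weakly Krull if $R=\bigcap_{P\in\mathfrak X(R)}R_P$ inside the quotient field of $R$ (the empty intersection being the whole quotient field) and every non-zero non-unit of $R$ is contained in only finitely many $P\in\mathfrak X(R)$. For an ideal $P$ of $D$, let $P[G]$ be the ideal of $D[G]$ consisting of the elements all of whose coefficients lie in $P$. The domain $D$ is called $G$-UMT if $$\mathfrak X(D[G])=\{P[G]\mid P\in\mathfrak X(D)\}\cup\{Q\cap D[G]\mid Q\in\mathfrak X(K[G])\}.$$ Then $D[G]$ is weakly Krull if and only if $D$ is weakly Krull and $G$-UMT. -/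

import Mathlib

/-- A torsion-free abelian group embeds in the rational vector space `ℚ ⊗ G`, so that its finite
subsets have unique sums. -/
theorem twoUniqueSums_of_torsionFree (G : Type*) [AddCommGroup G] [IsAddTorsionFree G] :
    TwoUniqueSums G := by
  have hinj : Function.Injective (TensorProduct.mk ℤ ℚ G 1) := by
    rw [injective_iff_map_eq_zero]
    intro g hg
    obtain ⟨c, hc⟩ := (IsLocalizedModule.eq_zero_iff (nonZeroDivisors ℤ)
      (TensorProduct.mk ℤ ℚ G 1)).1 hg
    exact (smul_eq_zero.1 hc).resolve_left (nonZeroDivisors.coe_ne_zero c)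
  exact TwoUniqueSums.of_injective_addHom (TensorProduct.mk ℤ ℚ G 1).toAddMonoidHom.toAddHom hinj
    inferInstance

/-- The group algebra of a torsion-free abelian group over a domain is a domain. -/
instance isDomain_groupAlgebra (D : Type*) [CommRing D] [IsDomain D] (G : Type*) [AddCommGroup G]
    [IsAddTorsionFree G] : IsDomain (AddMonoidAlgebra D G) := by
  have := twoUniqueSums_of_torsionFree G
  infer_instance

/-- The height-one spectrum of a commutative ring: the set of its prime ideals of height one. -/
def heightOneSpectrum (R : Type*) [CommRing R] : Set (Ideal R) :=
  {P | P.IsPrime ∧ P.height = 1}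

/-- A domain `R` is weakly Krull if `R = ⋂ R_P` inside its quotient field, `P` ranging over the
height-one primes, and each nonzero nonunit of `R` lies in only finitely many height-one primes.
The empty intersection is the whole quotient field. -/
structure IsWeaklyKrull (R : Type*) [CommRing R] [IsDomain R] : Prop where
  iInf_localization_eq_bot :
    (⨅ (P : PrimeSpectrum R) (_ : P.asIdeal ∈ heightOneSpectrum R),
      Localization.subalgebra.ofField (FractionRing R) P.asIdeal.primeCompl
        P.asIdeal.primeCompl_le_nonZeroDivisors) = (⊥ : Subalgebra R (FractionRing R))
  finite_character : ∀ x : R, x ≠ 0 → ¬ IsUnit x → {P ∈ heightOneSpectrum R | x ∈ P}.Finite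

/-- For an ideal `P` of `D`, the ideal `P[S]` of the monoid algebra `D[S]`, consisting of the
elements all of whose coefficients lie in `P`. -/
def coeffIdeal {D : Type*} [CommRing D] (S : Type*) [AddCancelCommMonoid S] (P : Ideal D) :
    Ideal (AddMonoidAlgebra D S) where
  carrier := {f | ∀ s : S, f.coeff s ∈ P}
  zero_mem' := fun s => by simp
  add_mem' := fun {f g} hf hg s => by simpa using P.add_mem (hf s) (hg s)
  smul_mem' := fun f g hg s => by
    classical
    rw [smul_eq_mul, AddMonoidAlgebra.coeff_mul]
    refine Submodule.sum_mem _ fun a _ => Submodule.sum_mem _ fun b _ => ?_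
    dsimp only
    split_ifs
    · exact P.mul_mem_left _ (hg b)
    · exact P.zero_mem

/-- A domain `D` with quotient field `K` is `S`-UMT if the height-one primes of `D[S]` are exactly
the ideals `P[S]`, for `P` a height-one prime of `D`, together with the contractions to `D[S]` of
the height-one primes of `K[S]`. -/
def IsMonoidUMT (D : Type*) [CommRing D] [IsDomain D] (S : Type*) [AddCancelCommMonoid S] : Prop :=
  heightOneSpectrum (AddMonoidAlgebra D S) =
    {A | ∃ P ∈ heightOneSpectrum D, A = coeffIdeal S P} ∪
    {A | ∃ Q ∈ heightOneSpectrum (AddMonoidAlgebra (FractionRing D) S),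
      A = Q.comap (AddMonoidAlgebra.mapRingHom S (algebraMap D (FractionRing D)))}

/-- The ascending chain condition on cyclic subgroups. -/
def ACCOnCyclicSubgroups (G : Type*) [AddCommGroup G] : Prop :=
  ∀ H : ℕ → AddSubgroup G, (∀ n, IsAddCyclic (H n)) → Monotone H → ∃ n, ∀ m, n ≤ m → H m = H n

/-! `K[G]` is the localization of `D[G]` at the nonzero constants. Hence a height-one prime of
`D[G]` without nonzero constants is contracted from a height-one prime of `K[G]`, while one
containing a nonzero constant is `P[G]` with `P` of height one. So `G`-UMT only asks that every such
`P[G]` have height one (`isMonoidUMT_iff`).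

The chain condition makes `K[G]` factorial (`uniqueFactorizationMonoid_groupAlgebra`), hence weakly
Krull. Irreducibles are prime because, up to a monomial, finitely many elements lie in a polynomial
ring. Factorizations stop because each nonunit factor of `f` contributes to an edge of the Newton
polygon of `f` in a generic plane projection; the chain condition bounds the contribution below
(`exists_divisor_measure`).

Let `D[G]` be weakly Krull and `0 ≠ a ∈ P`. If `P[G]` did not have height one, the finitely many
height-one primes over `a` would share a constant `β ∉ P`, and `a` would divide a power of `β`,
which is absurd. Divisibility and finiteness then descend to `D`.

Conversely, testing `b ∣ a` at the contracted primes gives a quotient `f / d` in `K[G]`. The primes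
`P[G]` remove `d`, since elements outside `P[G]` are nonzerodivisors modulo `d D_P[G]`
(`exists_constHom_dvd`). -/

/-! ### Degrees, initial forms and widths in a rational direction. -/

section InitialForms

variable {R : Type*} [CommRing R] {G : Type*} [AddCommGroup G]

open Classical in
/-- The degree of an element of a group algebra with respect to a homomorphism `θ : G →+ ℚ`: the
largest value of `θ` on the support (zero for the zero element). -/
noncomputable def thetaDegree (θ : G →+ ℚ) (f : AddMonoidAlgebra R G) : ℚ :=
  if h : f.coeff.support.Nonempty then f.coeff.support.sup' h θ else 0

/-- The initial form of an element of a group algebra: its terms of largest `θ`-value. -/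
noncomputable def initialForm (θ : G →+ ℚ) (f : AddMonoidAlgebra R G) : AddMonoidAlgebra R G :=
  .ofCoeff (f.coeff.filter fun x => θ x = thetaDegree θ f)

theorem support_nonempty_of_ne_zero {f : AddMonoidAlgebra R G} (hf : f ≠ 0) :
    f.coeff.support.Nonempty := by
  simpa [Finsupp.support_nonempty_iff] using hf

theorem le_thetaDegree (θ : G →+ ℚ) {f : AddMonoidAlgebra R G} {x : G}
    (hx : x ∈ f.coeff.support) : θ x ≤ thetaDegree θ f := by
  have h : f.coeff.support.Nonempty := ⟨x, hx⟩
  rw [thetaDegree, dif_pos h]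
  exact Finset.le_sup' θ hx

theorem exists_eq_thetaDegree (θ : G →+ ℚ) {f : AddMonoidAlgebra R G} (hf : f ≠ 0) :
    ∃ x ∈ f.coeff.support, θ x = thetaDegree θ f := by
  have h := support_nonempty_of_ne_zero hf
  rw [thetaDegree, dif_pos h]
  obtain ⟨x, hx, e⟩ := Finset.exists_mem_eq_sup' h θ
  exact ⟨x, hx, e.symm⟩

theorem thetaDegree_eq {θ : G →+ ℚ} {f : AddMonoidAlgebra R G} {q : ℚ}
    (hle : ∀ x ∈ f.coeff.support, θ x ≤ q) (hex : ∃ x ∈ f.coeff.support, θ x = q) :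
    thetaDegree θ f = q := by
  obtain ⟨x, hx, rfl⟩ := hex
  have hf : f ≠ 0 := by rintro rfl; simp at hx
  obtain ⟨y, hy, e⟩ := exists_eq_thetaDegree θ hf
  exact le_antisymm (e ▸ hle y hy) (le_thetaDegree θ hx)

theorem mem_support_initialForm {θ : G →+ ℚ} {f : AddMonoidAlgebra R G} {x : G} :
    x ∈ (initialForm θ f).coeff.support ↔ x ∈ f.coeff.support ∧ θ x = thetaDegree θ f := by
  simp [initialForm, AddMonoidAlgebra.coeff_ofCoeff]

theorem initialForm_ne_zero (θ : G →+ ℚ) {f : AddMonoidAlgebra R G} (hf : f ≠ 0) :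
    initialForm θ f ≠ 0 := by
  obtain ⟨x, hx, e⟩ := exists_eq_thetaDegree θ hf
  intro h
  have := mem_support_initialForm.2 ⟨hx, e⟩
  simp [h] at this

theorem exists_add_of_mem_support_mul {f g : AddMonoidAlgebra R G} {x : G}
    (hx : x ∈ (f * g).coeff.support) :
    ∃ a ∈ f.coeff.support, ∃ b ∈ g.coeff.support, a + b = x := by
  classical
  by_contra! h
  rw [Finsupp.mem_support_iff, AddMonoidAlgebra.coeff_mul] at hx
  exact hx (Finset.sum_eq_zero fun a ha => Finset.sum_eq_zero fun b hb => if_neg (h a ha b hb))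

theorem coeff_mul_eq_sum [DecidableEq G] {f g : AddMonoidAlgebra R G} {s t : Finset G}
    (hs : f.coeff.support ⊆ s) (ht : g.coeff.support ⊆ t) (x : G) :
    (f * g).coeff x = ∑ a ∈ s, ∑ b ∈ t, if a + b = x then f.coeff a * g.coeff b else 0 := by
  rw [AddMonoidAlgebra.coeff_mul, Finsupp.sum_of_support_subset _ hs _ (by simp)]
  exact Finset.sum_congr rfl fun a _ => Finsupp.sum_of_support_subset _ ht _ (by simp)

/-- Two exponents can add up to the top total degree only if each has top degree, so in that degree
the lower terms do not contribute. -/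
theorem coeff_initialForm_mul (θ : G →+ ℚ) (f g : AddMonoidAlgebra R G) (x : G) :
    (initialForm θ f * initialForm θ g).coeff x =
      if θ x = thetaDegree θ f + thetaDegree θ g then (f * g).coeff x else 0 := by
  classical
  have hsub (h : AddMonoidAlgebra R G) : (initialForm θ h).coeff.support ⊆ h.coeff.support :=
    fun y hy => (mem_support_initialForm.1 hy).1
  have key : ∀ a ∈ f.coeff.support, ∀ b ∈ g.coeff.support, a + b = x →
      (initialForm θ f).coeff a * (initialForm θ g).coeff b =
        if θ x = thetaDegree θ f + thetaDegree θ g then f.coeff a * g.coeff b else 0 := by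
    rintro a ha b hb rfl
    have h1 := le_thetaDegree θ ha
    have h2 := le_thetaDegree θ hb
    simp only [initialForm, AddMonoidAlgebra.coeff_ofCoeff, Finsupp.filter_apply, map_add]
    by_cases e : θ a = thetaDegree θ f
    · by_cases e' : θ b = thetaDegree θ g
      · simp [e, e']
      · have : θ a + θ b ≠ thetaDegree θ f + thetaDegree θ g := by
          intro h; exact e' (by linarith)
        simp [e', this]
    · have : θ a + θ b ≠ thetaDegree θ f + thetaDegree θ g := by
        intro h; exact e (by linarith)
      simp [e, this]
  rw [coeff_mul_eq_sum (hsub f) (hsub g), coeff_mul_eq_sum subset_rfl subset_rfl]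
  split_ifs with hθ
  · refine Finset.sum_congr rfl fun a ha => Finset.sum_congr rfl fun b hb => ?_
    split_ifs with hx
    · rw [key a ha b hb hx, if_pos hθ]
    · rfl
  · refine Finset.sum_eq_zero fun a ha => Finset.sum_eq_zero fun b hb => ?_
    split_ifs with hx
    · rw [key a ha b hb hx, if_neg hθ]
    · rfl

/-- The width of the support of an element of a group algebra in the direction `θ`. -/
noncomputable def thetaWidth (θ : G →+ ℚ) (f : AddMonoidAlgebra R G) : ℚ :=
  thetaDegree θ f + thetaDegree (-θ) f

theorem sub_le_thetaWidth (θ : G →+ ℚ) {f : AddMonoidAlgebra R G} {x y : G}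
    (hx : x ∈ f.coeff.support) (hy : y ∈ f.coeff.support) : θ x - θ y ≤ thetaWidth θ f := by
  have h1 := le_thetaDegree θ hx
  have h2 := le_thetaDegree (-θ) hy
  rw [AddMonoidHom.neg_apply] at h2
  rw [thetaWidth]
  linarith

theorem exists_eq_thetaWidth (θ : G →+ ℚ) {f : AddMonoidAlgebra R G} (hf : f ≠ 0) :
    ∃ x ∈ f.coeff.support, ∃ y ∈ f.coeff.support, thetaWidth θ f = θ x - θ y := by
  obtain ⟨x, hx, e⟩ := exists_eq_thetaDegree θ hf
  obtain ⟨y, hy, e'⟩ := exists_eq_thetaDegree (-θ) hf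
  refine ⟨x, hx, y, hy, ?_⟩
  rw [AddMonoidHom.neg_apply] at e'
  rw [thetaWidth, ← e, ← e', sub_eq_add_neg]

theorem thetaWidth_nonneg (θ : G →+ ℚ) {f : AddMonoidAlgebra R G} (hf : f ≠ 0) :
    0 ≤ thetaWidth θ f := by
  obtain ⟨x, hx⟩ := support_nonempty_of_ne_zero hf
  simpa using sub_le_thetaWidth θ hx hx

variable [IsDomain R] [IsAddTorsionFree G]

/-- The product of the initial forms is nonzero in a domain, so the top-degree part cannot cancel.
-/
theorem thetaDegree_mul (θ : G →+ ℚ) {f g : AddMonoidAlgebra R G} (hf : f ≠ 0) (hg : g ≠ 0) :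
    thetaDegree θ (f * g) = thetaDegree θ f + thetaDegree θ g := by
  refine thetaDegree_eq (fun x hx => ?_) ?_
  · obtain ⟨a, ha, b, hb, rfl⟩ := exists_add_of_mem_support_mul hx
    rw [map_add]
    exact add_le_add (le_thetaDegree θ ha) (le_thetaDegree θ hb)
  · obtain ⟨x, hx⟩ := support_nonempty_of_ne_zero
      (mul_ne_zero (initialForm_ne_zero θ hf) (initialForm_ne_zero θ hg))
    rw [Finsupp.mem_support_iff, coeff_initialForm_mul] at hx
    split_ifs at hx with h
    · exact ⟨x, Finsupp.mem_support_iff.2 hx, h⟩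
    · exact absurd rfl hx

theorem initialForm_mul (θ : G →+ ℚ) {f g : AddMonoidAlgebra R G} (hf : f ≠ 0) (hg : g ≠ 0) :
    initialForm θ (f * g) = initialForm θ f * initialForm θ g := by
  ext x
  rw [coeff_initialForm_mul, initialForm, AddMonoidAlgebra.coeff_ofCoeff, Finsupp.filter_apply,
    thetaDegree_mul θ hf hg]

theorem thetaWidth_mul (θ : G →+ ℚ) {f g : AddMonoidAlgebra R G} (hf : f ≠ 0) (hg : g ≠ 0) :
    thetaWidth θ (f * g) = thetaWidth θ f + thetaWidth θ g := by
  simp only [thetaWidth, thetaDegree_mul _ hf hg]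
  ring

theorem thetaWidth_le_of_dvd (θ : G →+ ℚ) {f g : AddMonoidAlgebra R G} (hf : f ≠ 0) (h : g ∣ f) :
    thetaWidth θ g ≤ thetaWidth θ f := by
  obtain ⟨k, rfl⟩ := h
  rw [thetaWidth_mul θ (left_ne_zero_of_mul hf) (right_ne_zero_of_mul hf)]
  have := thetaWidth_nonneg θ (right_ne_zero_of_mul hf)
  linarith

theorem initialForm_dvd (θ : G →+ ℚ) {f g : AddMonoidAlgebra R G} (hf : f ≠ 0) (h : g ∣ f) :
    initialForm θ g ∣ initialForm θ f := by
  obtain ⟨k, rfl⟩ := h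
  rw [initialForm_mul θ (left_ne_zero_of_mul hf) (right_ne_zero_of_mul hf)]
  exact dvd_mul_right _ _

end InitialForms

/-! ### Rational functionals on `G` and lines in `G`. -/

section RationalFunctionals

variable {G : Type*} [AddCommGroup G] [IsAddTorsionFree G]

theorem tensorProduct_mk_one_injective :
    Function.Injective (TensorProduct.mk ℤ ℚ G 1) := by
  rw [injective_iff_map_eq_zero]
  intro g hg
  obtain ⟨c, hc⟩ := (IsLocalizedModule.eq_zero_iff (nonZeroDivisors ℤ)
    (TensorProduct.mk ℤ ℚ G 1)).1 hg
  exact (smul_eq_zero.1 hc).resolve_left (nonZeroDivisors.coe_ne_zero c)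

theorem exists_zsmul_eq_of_tensorProduct_mk_eq_smul {x y : G} {q : ℚ}
    (h : TensorProduct.mk ℤ ℚ G 1 y = q • TensorProduct.mk ℤ ℚ G 1 x) :
    ∃ m : ℤ, m ≠ 0 ∧ ∃ n : ℤ, m • y = n • x := by
  refine ⟨q.den, by exact_mod_cast q.den_nz, q.num, tensorProduct_mk_one_injective ?_⟩
  rw [map_zsmul, map_zsmul, h, ← Int.cast_smul_eq_zsmul ℚ, ← Int.cast_smul_eq_zsmul ℚ, smul_smul]
  congr 1
  rw [Int.cast_natCast, mul_comm, Rat.mul_den_eq_num]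

/-- The homomorphism `G →+ ℚ` induced by a functional on `ℚ ⊗ G`. -/
noncomputable def ofDual (F : Module.Dual ℚ (TensorProduct ℤ ℚ G)) : G →+ ℚ :=
  F.toAddMonoidHom.comp (TensorProduct.mk ℤ ℚ G 1).toAddMonoidHom

theorem exists_zsmul_eq_of_forall_functional {d x : G}
    (h : ∀ ω : G →+ ℚ, ω d = 0 → ω x = 0) : ∃ m : ℤ, m ≠ 0 ∧ ∃ n : ℤ, m • x = n • d := by
  by_cases hx : TensorProduct.mk ℤ ℚ G 1 x ∈ Submodule.span ℚ {TensorProduct.mk ℤ ℚ G 1 d}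
  · obtain ⟨q, hq⟩ := Submodule.mem_span_singleton.1 hx
    exact exists_zsmul_eq_of_tensorProduct_mk_eq_smul hq.symm
  · obtain ⟨F, hF, hle⟩ := Submodule.exists_le_ker_of_notMem hx
    exact absurd (h (ofDual F) (hle (Submodule.mem_span_singleton_self _))) hF

/-- Some functional is nonzero at each of finitely many given nonzero vectors. This is used twice:
`F` for the nonzero elements of `S`, then `E` for the nonzero vectors `F(y) x - F(x) y`. If `E`
kills such a combination, it is zero and `y` is proportional to `x`. -/
theorem exists_generic_functionals (S : Finset G) :
    ∃ φ ψ : G →+ ℚ, (∀ x ∈ S, x ≠ 0 → ψ x ≠ 0) ∧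
      ∀ x ∈ S, ∀ y ∈ S, φ x * ψ y = φ y * ψ x → x ≠ 0 →
        ∃ m : ℤ, m ≠ 0 ∧ ∃ n : ℤ, m • y = n • x := by
  obtain ⟨F, hF⟩ := Module.exists_dual_forall_apply_ne_zero (K := ℚ)
    (fun x : {x : S // (x : G) ≠ 0} => TensorProduct.mk ℤ ℚ G 1 (x : G))
    (fun x => by rw [Ne, map_eq_zero_iff _ tensorProduct_mk_one_injective]; exact x.2)
  let w : S × S → TensorProduct ℤ ℚ G := fun p =>
    F (TensorProduct.mk ℤ ℚ G 1 p.2) • TensorProduct.mk ℤ ℚ G 1 (p.1 : G) -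
      F (TensorProduct.mk ℤ ℚ G 1 p.1) • TensorProduct.mk ℤ ℚ G 1 (p.2 : G)
  obtain ⟨E, hE⟩ := Module.exists_dual_forall_apply_ne_zero (K := ℚ)
    (fun p : {p : S × S // w p ≠ 0} => w p) (fun p => p.2)
  refine ⟨ofDual E, ofDual F, fun x hx h0 => hF ⟨⟨x, hx⟩, h0⟩, fun x hx y hy hxy h0 => ?_⟩
  have hFx : F (TensorProduct.mk ℤ ℚ G 1 x) ≠ 0 := hF ⟨⟨x, hx⟩, h0⟩
  have hw : w (⟨x, hx⟩, ⟨y, hy⟩) = 0 := by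
    by_contra hne
    refine hE ⟨_, hne⟩ ?_
    change E (_ • _ - _ • _) = 0
    rw [map_sub, map_smul, map_smul, smul_eq_mul, smul_eq_mul, sub_eq_zero, mul_comm,
      mul_comm (F _)]
    exact hxy
  refine exists_zsmul_eq_of_tensorProduct_mk_eq_smul
    (q := (F (TensorProduct.mk ℤ ℚ G 1 x))⁻¹ * F (TensorProduct.mk ℤ ℚ G 1 y)) ?_
  rw [mul_smul, sub_eq_zero.1 hw, smul_smul, inv_mul_cancel₀ hFx, one_smul]

/-- The rational line through a nonzero element meets `G` in a cyclic group. -/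
theorem exists_generator_of_line (hG : ACCOnCyclicSubgroups G) {d : G} (hd : d ≠ 0) :
    ∃ e : G, e ≠ 0 ∧ (∃ k : ℤ, d = k • e) ∧
      ∀ x : G, (∃ m : ℤ, m ≠ 0 ∧ ∃ n : ℤ, m • x = n • d) → ∃ k : ℤ, x = k • e := by
  -- The chain condition yields a maximal cyclic subgroup containing `d`; its generator is the
  -- required `e`.
  have hwf : WellFoundedGT {H : AddSubgroup G // IsAddCyclic H} := by
    rw [wellFoundedGT_iff_monotone_chain_condition]
    intro a
    obtain ⟨n, hn⟩ := hG (fun i => (a i).1) (fun i => (a i).2) (fun i j h => a.monotone h)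
    exact ⟨n, fun m hm => Subtype.ext (hn m hm).symm⟩
  let T : Set {H : AddSubgroup G // IsAddCyclic H} := {H | d ∈ H.1}
  have hT : T.Nonempty := ⟨⟨AddSubgroup.zmultiples d, inferInstance⟩,
    AddSubgroup.mem_zmultiples d⟩
  obtain ⟨⟨H, hH⟩, hHd, hmax⟩ := hwf.wf.has_min T hT
  obtain ⟨e, rfl⟩ := (AddSubgroup.isAddCyclic_iff_exists_zmultiples_eq_top H).1 hH
  obtain ⟨k, hk⟩ := AddSubgroup.mem_zmultiples_iff.1 hHd
  have hk0 : k ≠ 0 := by rintro rfl; exact hd (by simpa using hk.symm)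
  have he : e ≠ 0 := by rintro rfl; exact hd (by simpa using hk.symm)
  refine ⟨e, he, ⟨k, hk.symm⟩, ?_⟩
  rintro x ⟨m, hm, n, hmn⟩
  rw [← hk, smul_smul] at hmn
  set n' := n * k
  obtain ⟨g, hg, m', n'', hcop, rfl, hn⟩ : ∃ g : ℤ, g ≠ 0 ∧ ∃ m' n'' : ℤ, IsCoprime m' n'' ∧
      m = g * m' ∧ n' = g * n'' := by
    have hg : (Int.gcd m n' : ℤ) ≠ 0 := by
      exact_mod_cast (Int.gcd_pos_of_ne_zero_left _ hm).ne'
    refine ⟨Int.gcd m n', hg, m / Int.gcd m n', n' / Int.gcd m n', ?_,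
      (Int.mul_ediv_cancel' (Int.gcd_dvd_left _ _)).symm,
      (Int.mul_ediv_cancel' (Int.gcd_dvd_right _ _)).symm⟩
    exact Int.isCoprime_iff_gcd_eq_one.2
      (Int.gcd_ediv_gcd_ediv_gcd (Int.gcd_pos_of_ne_zero_left _ hm))
  rw [hn, mul_smul, mul_smul] at hmn
  have hmn' : m' • x = n'' • e := zsmul_right_injective hg hmn
  obtain ⟨u, v, huv⟩ := hcop
  -- By Bézout, `y` generates both `e` and `x`, so maximality of the subgroup of `e` puts `y`, and
  -- with it `x`, inside it.
  set y := u • e + v • x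
  have hy : m' • y = e := by
    calc m' • y = u • m' • e + v • m' • x := by simp only [y, smul_add, smul_smul, mul_comm]
      _ = (u * m' + v * n'') • e := by rw [hmn', add_smul, mul_smul, mul_smul]
      _ = e := by rw [huv, one_smul]
  have hxy : n'' • y = x := by
    calc n'' • y = u • n'' • e + v • n'' • x := by simp only [y, smul_add, smul_smul, mul_comm]
      _ = (u * m' + v * n'') • x := by rw [← hmn', add_smul, mul_smul, mul_smul]
      _ = x := by rw [huv, one_smul]
  have hle : AddSubgroup.zmultiples e ≤ AddSubgroup.zmultiples y := by
    rw [AddSubgroup.zmultiples_le]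
    exact AddSubgroup.mem_zmultiples_iff.2 ⟨m', hy⟩
  have hge : AddSubgroup.zmultiples y ≤ AddSubgroup.zmultiples e := by
    by_contra hcon
    exact hmax ⟨AddSubgroup.zmultiples y, inferInstance⟩ (hle hHd)
      (lt_of_le_not_ge hle hcon : AddSubgroup.zmultiples e < AddSubgroup.zmultiples y)
  obtain ⟨l, hl⟩ := AddSubgroup.mem_zmultiples_iff.1
    (hge (AddSubgroup.mem_zmultiples_iff.2 ⟨n'', hxy⟩))
  exact ⟨l, hl.symm⟩

end RationalFunctionals

/-! ### Finiteness of factorizations in `K[G]` via Newton polygons. -/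

section BoundedFactorization

variable {K : Type*} [Field K] {G : Type*} [AddCommGroup G]

theorem isUnit_single (x : G) {k : K} (hk : k ≠ 0) :
    IsUnit (AddMonoidAlgebra.single x k) := by
  refine IsUnit.of_mul_eq_one (AddMonoidAlgebra.single (-x) k⁻¹) ?_
  rw [AddMonoidAlgebra.single_mul_single, add_neg_cancel, mul_inv_cancel₀ hk,
    AddMonoidAlgebra.one_def]

theorem isUnit_of_support_subsingleton {f : AddMonoidAlgebra K G} (hf : f ≠ 0)
    (h : ∀ x ∈ f.coeff.support, ∀ y ∈ f.coeff.support, x = y) : IsUnit f := by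
  classical
  obtain ⟨x, hx⟩ := support_nonempty_of_ne_zero hf
  have : f = AddMonoidAlgebra.single x (f.coeff x) := by
    ext y
    rw [AddMonoidAlgebra.coeff_single, Finsupp.single_apply]
    split_ifs with hxy
    · rw [hxy]
    · by_contra hy
      exact hxy (h x hx y (Finsupp.mem_support_iff.2 hy))
  rw [this]
  exact isUnit_single x (Finsupp.mem_support_iff.1 hx)

/-- The functional `φ + t ψ`. -/
noncomputable def pencil (φ ψ : G →+ ℚ) (t : ℚ) : G →+ ℚ := φ + (AddMonoidHom.mulLeft t).comp ψ

theorem pencil_apply (φ ψ : G →+ ℚ) (t : ℚ) (x : G) : pencil φ ψ t x = φ x + t * ψ x := rfl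

/-- If `ψ` is not constant on the support of `f`, then some member of the pencil spanned by `φ` and
`ψ` cuts out an edge of the support on which `ψ` is not constant. -/
theorem exists_edge (φ ψ : G →+ ℚ) {f : AddMonoidAlgebra K G} {x y : G}
    (hx : x ∈ f.coeff.support) (hy : y ∈ f.coeff.support) (hxy : ψ x ≠ ψ y) :
    ∃ t : ℚ, ∃ a ∈ (initialForm (pencil φ ψ t) f).coeff.support,
      ∃ b ∈ (initialForm (pencil φ ψ t) f).coeff.support, ψ a ≠ ψ b := by
  classical
  -- In the `(ψ, φ)`-plane, `a` is the highest of the leftmost points and `b` a point of steepest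
  -- slope `s` seen from `a`. Thus `φ - s ψ` is maximal at both.
  obtain ⟨a₀, ha₀, hmin⟩ := Finset.exists_min_image f.coeff.support ψ ⟨x, hx⟩
  obtain ⟨a, ha, hmax⟩ := Finset.exists_max_image (f.coeff.support.filter fun z => ψ z = ψ a₀) φ
    ⟨a₀, by simpa using ha₀⟩
  rw [Finset.mem_filter] at ha
  have hne : (f.coeff.support.filter fun z => ψ a < ψ z).Nonempty := by
    rcases hxy.lt_or_gt with h | h
    · exact ⟨y, Finset.mem_filter.2 ⟨hy, ha.2 ▸ (hmin x hx).trans_lt h⟩⟩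
    · exact ⟨x, Finset.mem_filter.2 ⟨hx, ha.2 ▸ (hmin y hy).trans_lt h⟩⟩
  obtain ⟨b, hb, hslope⟩ := Finset.exists_max_image _ (fun z => (φ z - φ a) / (ψ z - ψ a)) hne
  rw [Finset.mem_filter] at hb
  set s := (φ b - φ a) / (ψ b - ψ a) with hs
  have hab : φ b - φ a = s * (ψ b - ψ a) := by
    rw [hs, div_mul_cancel₀ _ (sub_pos.2 hb.2).ne']
  have hle : ∀ z ∈ f.coeff.support, pencil φ ψ (-s) z ≤ pencil φ ψ (-s) a := by
    intro z hz
    rw [pencil_apply, pencil_apply]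
    rcases (hmin z hz).eq_or_lt with h | h
    · have := hmax z (Finset.mem_filter.2 ⟨hz, h.symm⟩)
      rw [← h, ha.2]
      linarith
    · rw [← ha.2] at h
      have := hslope z (Finset.mem_filter.2 ⟨hz, h⟩)
      rw [div_le_iff₀ (sub_pos.2 h)] at this
      linarith
  have hdeg : thetaDegree (pencil φ ψ (-s)) f = pencil φ ψ (-s) a :=
    thetaDegree_eq hle ⟨a, ha.1, rfl⟩
  refine ⟨-s, a, mem_support_initialForm.2 ⟨ha.1, hdeg.symm⟩, b,
    mem_support_initialForm.2 ⟨hb.1, ?_⟩, hb.2.ne⟩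
  rw [hdeg, pencil_apply, pencil_apply]
  linarith

variable [IsAddTorsionFree G]

/-- If the support of `F` lies on a line, then the widths of its divisors are discrete. -/
theorem exists_width_gap (hG : ACCOnCyclicSubgroups G) (ψ : G →+ ℚ) {F : AddMonoidAlgebra K G}
    (hF : F ≠ 0)
    (hψ : ∀ a ∈ F.coeff.support, ∀ b ∈ F.coeff.support, a ≠ b → ψ a ≠ ψ b)
    (hline : ∀ a ∈ F.coeff.support, ∀ b ∈ F.coeff.support, ∀ x ∈ F.coeff.support,
      ∀ y ∈ F.coeff.support, a ≠ b → ∃ m : ℤ, m ≠ 0 ∧ ∃ n : ℤ, m • (x - y) = n • (a - b)) :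
    ∃ c : ℚ, 0 < c ∧ ∀ h, h ∣ F → thetaWidth ψ h = 0 ∨ c ≤ thetaWidth ψ h := by
  by_cases hsub : ∀ a ∈ F.coeff.support, ∀ b ∈ F.coeff.support, a = b
  · refine ⟨1, one_pos, fun h hh => Or.inl (le_antisymm ?_ (thetaWidth_nonneg ψ
      (ne_zero_of_dvd_ne_zero hF hh)))⟩
    obtain ⟨x, hx, y, hy, e⟩ := exists_eq_thetaWidth ψ hF
    refine (thetaWidth_le_of_dvd ψ hF hh).trans ?_
    rw [e, hsub x hx y hy, sub_self]
  push Not at hsub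
  obtain ⟨a, ha, b, hb, hab⟩ := hsub
  obtain ⟨e, -, ⟨k, hk⟩, he⟩ := exists_generator_of_line hG (sub_ne_zero.2 hab)
  have hψe : ψ e ≠ 0 := by
    intro h0
    have := congrArg ψ hk
    rw [map_sub, map_zsmul, h0, smul_zero, sub_eq_zero] at this
    exact hψ a ha b hb hab this
  refine ⟨|ψ e|, abs_pos.2 hψe, fun h hh => ?_⟩
  have h0 := ne_zero_of_dvd_ne_zero hF hh
  obtain ⟨x, hx, y, hy, hw⟩ := exists_eq_thetaWidth ψ h0
  -- A functional killing `a - b` has width zero on `F`, hence on its divisor `h`, so it kills `x -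
  -- y`. Functionals detect lines, so `x - y` is an integer multiple of `e`.
  obtain ⟨l, hl⟩ := he (x - y) (exists_zsmul_eq_of_forall_functional fun ω hω => by
    have hωF : thetaWidth ω F = 0 := by
      obtain ⟨x', hx', y', hy', e'⟩ := exists_eq_thetaWidth ω hF
      obtain ⟨m, hm, n, hmn⟩ := hline a ha b hb x' hx' y' hy' hab
      have := congrArg ω hmn
      rw [map_zsmul, map_zsmul, hω, smul_zero, map_sub, ← e'] at this
      exact (smul_eq_zero.1 this).resolve_left hm
    have hωh := thetaWidth_le_of_dvd ω hF hh
    have h1 := sub_le_thetaWidth ω hx hy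
    have h2 := sub_le_thetaWidth ω hy hx
    rw [map_sub]
    linarith)
  have hw' : thetaWidth ψ h = l * ψ e := by
    rw [hw, ← map_sub, hl, map_zsmul, zsmul_eq_mul]
  rcases eq_or_ne l 0 with rfl | hl0
  · left; simpa using hw'
  · right
    rw [← abs_of_nonneg (thetaWidth_nonneg ψ h0), hw', abs_mul]
    refine le_mul_of_one_le_left (abs_nonneg _) ?_
    exact_mod_cast Int.one_le_abs hl0

/-- The measure adds, over the possible edges, the integer part of edge width over minimal width.
Widths add under products, so floors are superadditive; a nonunit `h` has an edge, which raises one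
term by at least one. Genericity of `φ, ψ` makes edge supports collinear in `G`, as
`exists_width_gap` needs. -/
theorem exists_divisor_measure (hG : ACCOnCyclicSubgroups G) {f : AddMonoidAlgebra K G}
    (hf : f ≠ 0) :
    ∃ μ : AddMonoidAlgebra K G → ℕ, ∀ g h, g * h ∣ f → ¬ IsUnit h → μ g < μ (g * h) := by
  classical
  set S := f.coeff.support
  obtain ⟨φ, ψ, hψ, hgen⟩ := exists_generic_functionals
    ((S ×ˢ S).image fun p => p.1 - p.2)
  have hmem {a b : G} (ha : a ∈ S) (hb : b ∈ S) : a - b ∈ (S ×ˢ S).image fun p => p.1 - p.2 :=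
    Finset.mem_image.2 ⟨(a, b), Finset.mk_mem_product ha hb, rfl⟩
  have hψ' : ∀ a ∈ S, ∀ b ∈ S, a ≠ b → ψ a ≠ ψ b := fun a ha b hb hab => by
    simpa [sub_eq_zero] using hψ _ (hmem ha hb) (sub_ne_zero.2 hab)
  have hgap (t : ℚ) : ∃ c : ℚ, 0 < c ∧ ∀ h, h ∣ initialForm (pencil φ ψ t) f →
      thetaWidth ψ h = 0 ∨ c ≤ thetaWidth ψ h := by
    refine exists_width_gap hG ψ (initialForm_ne_zero _ hf)
      (fun a ha b hb => hψ' a (mem_support_initialForm.1 ha).1 b (mem_support_initialForm.1 hb).1)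
      fun a ha b hb x hx y hy hab => ?_
    rw [mem_support_initialForm] at ha hb hx hy
    refine hgen _ (hmem ha.1 hb.1) _ (hmem hx.1 hy.1) ?_ (sub_ne_zero.2 hab)
    have h1 := ha.2.trans hb.2.symm
    have h2 := hx.2.trans hy.2.symm
    rw [pencil_apply, pencil_apply] at h1 h2
    simp only [map_sub]
    have h3 : φ a - φ b = -t * (ψ a - ψ b) := by linarith
    have h4 : φ x - φ y = -t * (ψ x - ψ y) := by linarith
    rw [h3, h4]
    ring
  choose c hc hcw using hgap
  let w : ℚ → AddMonoidAlgebra K G → ℚ := fun t h => thetaWidth ψ (initialForm (pencil φ ψ t) h)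
  -- An edge through two support points of distinct `ψ`-value has minus their slope as parameter.
  -- Pairs with equal `ψ`-value only add the harmless value `0`.
  let T : Finset ℚ := (S ×ˢ S).image fun p => -((φ p.1 - φ p.2) / (ψ p.1 - ψ p.2))
  refine ⟨fun g => ∑ t ∈ T, ⌊w t g / c t⌋₊, fun g h hgh hu => ?_⟩
  have hgh0 := ne_zero_of_dvd_ne_zero hf hgh
  have hg0 := left_ne_zero_of_mul hgh0
  have hh0 := right_ne_zero_of_mul hgh0
  have hhf : h ∣ f := (dvd_mul_left h g).trans hgh
  have hwn {k : AddMonoidAlgebra K G} (hk : k ≠ 0) (t : ℚ) : 0 ≤ w t k / c t :=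
    div_nonneg (thetaWidth_nonneg ψ (initialForm_ne_zero _ hk)) (hc t).le
  have hsum (t : ℚ) : ⌊w t g / c t⌋₊ + ⌊w t h / c t⌋₊ ≤ ⌊w t (g * h) / c t⌋₊ := by
    have : w t (g * h) = w t g + w t h := by
      simp only [w]
      rw [initialForm_mul _ hg0 hh0,
        thetaWidth_mul _ (initialForm_ne_zero _ hg0) (initialForm_ne_zero _ hh0)]
    rw [this, add_div]
    rw [Nat.le_floor_iff (add_nonneg (hwn hg0 t) (hwn hh0 t)), Nat.cast_add]
    exact add_le_add (Nat.floor_le (hwn hg0 t)) (Nat.floor_le (hwn hh0 t))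
  -- Otherwise `h` is its own `ψ`-initial form and divides that of `f`. The latter is a monomial, as
  -- `ψ` is injective on the support of `f`, so `h` would be a unit.
  obtain ⟨x, hx, y, hy, hxy⟩ : ∃ x ∈ h.coeff.support, ∃ y ∈ h.coeff.support, ψ x ≠ ψ y := by
    by_contra! hcon
    have hlead : initialForm ψ h = h := by
      ext z
      rw [initialForm, AddMonoidAlgebra.coeff_ofCoeff, Finsupp.filter_apply]
      split_ifs with hz
      · rfl
      · by_contra hne
        obtain ⟨z', hz', e⟩ := exists_eq_thetaDegree ψ hh0
        exact hz (e ▸ hcon z (Finsupp.mem_support_iff.2 (Ne.symm hne)) z' hz')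
    have hunit : IsUnit (initialForm ψ f) := by
      refine isUnit_of_support_subsingleton (initialForm_ne_zero ψ hf) fun a ha b hb => ?_
      rw [mem_support_initialForm] at ha hb
      by_contra hab
      exact hψ' a ha.1 b hb.1 hab (ha.2.trans hb.2.symm)
    exact hu (isUnit_of_dvd_unit (hlead ▸ initialForm_dvd ψ hf hhf) hunit)
  obtain ⟨t, a, ha, b, hb, hab⟩ := exists_edge φ ψ hx hy hxy
  have hpos : 0 < w t h := by
    have h1 := sub_le_thetaWidth ψ ha hb
    have h2 := sub_le_thetaWidth ψ hb ha
    rcases hab.lt_or_gt with h | h <;> simp only [w] <;> linarith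
  have htT : t ∈ T := by
    have hF0 := initialForm_ne_zero (pencil φ ψ t) hf
    have hwf : 0 < thetaWidth ψ (initialForm (pencil φ ψ t) f) :=
      hpos.trans_le (thetaWidth_le_of_dvd ψ hF0 (initialForm_dvd _ hf hhf))
    obtain ⟨x', hx', y', hy', e⟩ := exists_eq_thetaWidth ψ hF0
    rw [e] at hwf
    rw [mem_support_initialForm] at hx' hy'
    refine Finset.mem_image.2 ⟨(x', y'), Finset.mk_mem_product hx'.1 hy'.1, ?_⟩
    have h1 := hx'.2.trans hy'.2.symm
    rw [pencil_apply, pencil_apply] at h1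
    rw [← neg_div, div_eq_iff hwf.ne']
    linarith
  have hone : 1 ≤ ⌊w t h / c t⌋₊ := by
    rw [Nat.one_le_floor_iff, one_le_div (hc t)]
    exact (hcw t _ (initialForm_dvd _ hf hhf)).resolve_left hpos.ne'
  refine Finset.sum_lt_sum (fun s _ => (Nat.le_add_right _ _).trans (hsum s)) ⟨t, htT, ?_⟩
  have := hsum t
  omega

theorem wfDvdMonoid_groupAlgebra (K : Type*) [Field K] (hG : ACCOnCyclicSubgroups G) :
    WfDvdMonoid (AddMonoidAlgebra K G) := by
  have hacc : ∀ f : AddMonoidAlgebra K G, f ≠ 0 → Acc DvdNotUnit f := by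
    intro f hf
    obtain ⟨μ, hμ⟩ := exists_divisor_measure hG hf
    have key : ∀ n, ∀ g, g ∣ f → μ g = n → Acc DvdNotUnit g := by
      intro n
      induction n using Nat.strong_induction_on with
      | _ n ih =>
        rintro g hg rfl
        refine ⟨_, ?_⟩
        rintro k ⟨-, x, hx, rfl⟩
        exact ih _ (hμ k x hg hx) k ((dvd_mul_right k x).trans hg) rfl
    exact key _ f dvd_rfl rfl
  refine ⟨⟨fun f => ?_⟩⟩
  by_cases hf : f = 0
  · exact ⟨_, fun g hg => hacc g hg.1⟩
  · exact hacc f hf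

end BoundedFactorization

/-! ### Factoriality of `K[G]` by reduction to polynomial rings. -/

section Factorial

variable {G : Type*} [AddCommGroup G] [IsAddTorsionFree G]

/-- Up to a translation, every finite subset of a torsion-free abelian group lies in a finitely
generated free submonoid. -/
theorem exists_free_submonoid (S : Finset G) :
    ∃ (n : ℕ) (ι : (Fin n →₀ ℕ) →+ G) (x₀ : G), Function.Injective ι ∧
      ∀ s ∈ S, x₀ + s ∈ Set.range ι := by
  classical
  let H : Submodule ℤ G := Submodule.span ℤ (S : Set G)
  have : Module.Finite ℤ H := Module.Finite.span_of_finite ℤ S.finite_toSet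
  let b := Module.finBasis ℤ H
  let ι : (Fin (Module.finrank ℤ H) →₀ ℕ) →+ G :=
    (H.subtype.toAddMonoidHom.comp b.repr.symm.toLinearMap.toAddMonoidHom).comp
      (Finsupp.mapRange.addMonoidHom (Nat.castAddMonoidHom ℤ))
  have hι (v) : ι v =
      (b.repr.symm (Finsupp.mapRange (Nat.castAddMonoidHom ℤ) (map_zero _) v) : H) :=
    rfl
  -- `N` bounds all coordinates of elements of `S`, so translating by `(N, ..., N)` makes them
  -- nonnegative.
  let N : ℕ := ∑ s ∈ S.attach, ∑ i, (b.repr ⟨s, Submodule.subset_span s.2⟩ i).natAbs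
  let v₀ : Fin (Module.finrank ℤ H) →₀ ℤ := Finsupp.equivFunOnFinite.symm fun _ => (N : ℤ)
  refine ⟨_, ι, (b.repr.symm v₀ : H), ?_, fun s hs => ?_⟩
  · intro v w hvw
    rw [hι, hι, Subtype.coe_inj, b.repr.symm.injective.eq_iff] at hvw
    exact Finsupp.mapRange_injective _ (map_zero _) Nat.cast_injective hvw
  · let s' : H := ⟨s, Submodule.subset_span hs⟩
    refine ⟨Finsupp.equivFunOnFinite.symm fun i => ((N : ℤ) + b.repr s' i).toNat, ?_⟩
    rw [hι]
    change _ = ((b.repr.symm v₀ + s' : H) : G)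
    congr 1
    rw [LinearEquiv.symm_apply_eq, map_add, LinearEquiv.apply_symm_apply]
    ext i
    have h1 : (b.repr s' i).natAbs ≤ N :=
      (Finset.single_le_sum (f := fun i => (b.repr s' i).natAbs) (fun _ _ => Nat.zero_le _)
        (Finset.mem_univ i)).trans
      (Finset.single_le_sum
        (f := fun s : S => ∑ i, (b.repr ⟨s, Submodule.subset_span s.2⟩ i).natAbs)
        (fun _ _ => Nat.zero_le _) (Finset.mem_attach S ⟨s, hs⟩))
    have h2 : 0 ≤ (N : ℤ) + b.repr s' i := by omega
    simp [v₀, Int.toNat_of_nonneg h2]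

theorem exists_polynomial_chart (K : Type*) [Field K] (F : Finset (AddMonoidAlgebra K G)) :
    ∃ (n : ℕ) (ι : MvPolynomial (Fin n) K →+* AddMonoidAlgebra K G) (u : AddMonoidAlgebra K G),
      Function.Injective ι ∧ IsUnit u ∧ ∀ f ∈ F, ∃ q, ι q = u * f := by
  classical
  obtain ⟨n, ι, x₀, hι, hx₀⟩ := exists_free_submonoid (F.biUnion fun f => f.coeff.support)
  refine ⟨n, AddMonoidAlgebra.mapDomainRingHom K ι, AddMonoidAlgebra.single x₀ 1,
    AddMonoidAlgebra.mapDomain_injective hι, isUnit_single x₀ one_ne_zero, fun f hf => ?_⟩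
  refine ⟨AddMonoidAlgebra.comapDomain ι hι (AddMonoidAlgebra.single x₀ 1 * f),
    AddMonoidAlgebra.mapDomain_comapDomain (fun y hy => ?_) _⟩
  obtain ⟨a, ha, b, hb, rfl⟩ := exists_add_of_mem_support_mul hy
  rw [AddMonoidAlgebra.coeff_single] at ha
  rw [Finset.mem_singleton.1 (Finsupp.support_single_subset ha)]
  exact hx₀ b (Finset.mem_biUnion.2 ⟨f, hf, hb⟩)

theorem exists_prime_dvd_not_isUnit_map {A B : Type*} [CommRing A] [IsDomain A]
    [UniqueFactorizationMonoid A] [CommRing B] (ι : A →+* B) {r : A} (hr : r ≠ 0)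
    (hu : ¬ IsUnit (ι r)) : ∃ q, Prime q ∧ q ∣ r ∧ ¬ IsUnit (ι q) := by
  induction r using UniqueFactorizationMonoid.induction_on_prime with
  | h₁ => exact absurd rfl hr
  | h₂ x hx => exact absurd (hx.map ι) hu
  | h₃ a p ha hp ih =>
    by_cases hpu : IsUnit (ι p)
    · rw [map_mul, IsUnit.mul_iff] at hu
      obtain ⟨q, hq, hqa, hqu⟩ := ih ha fun h => hu ⟨hpu, h⟩
      exact ⟨q, hq, hqa.mul_left p, hqu⟩
    · exact ⟨p, hp, dvd_mul_right p a, hpu⟩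

/-- In a polynomial chart the preimage `p'` of `p` may be reducible, but it has a prime factor `q`
with nonunit image. Irreducibility makes the cofactor a unit in `K[G]`, so `p` divides the image of
`q`, and primality of `q` passes to `p`. -/
theorem prime_of_irreducible_groupAlgebra {K : Type*} [Field K] {p : AddMonoidAlgebra K G}
    (hp : Irreducible p) : Prime p := by
  classical
  refine ⟨hp.ne_zero, hp.not_isUnit, ?_⟩
  rintro a b ⟨c, hc⟩
  obtain ⟨n, ι, u, hι, hu, hF⟩ := exists_polynomial_chart K {p, c, a, b}
  obtain ⟨p', hp'⟩ := hF p (by simp)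
  obtain ⟨c', hc'⟩ := hF c (by simp)
  obtain ⟨a', ha'⟩ := hF a (by simp)
  obtain ⟨b', hb'⟩ := hF b (by simp)
  have hmul : a' * b' = p' * c' := hι <| by
    rw [map_mul, map_mul, ha', hb', hp', hc']
    linear_combination u * u * hc
  have hirr : Irreducible (ι p') := by
    rw [hp']
    exact (irreducible_isUnit_mul hu).2 hp
  obtain ⟨q, hq, ⟨r, hr⟩, hqu⟩ := exists_prime_dvd_not_isUnit_map ι
    (by rintro rfl; exact hirr.ne_zero (map_zero ι)) hirr.not_isUnit
  have hru : IsUnit (ι r) := (hirr.isUnit_or_isUnit (by rw [← map_mul, ← hr])).resolve_left hqu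
  have hpq : p ∣ ι q := by
    rw [← hru.dvd_mul_right, ← map_mul, ← hr, hp']
    exact dvd_mul_left p u
  have hab : q ∣ a' * b' := ⟨r * c', by rw [hmul, hr, mul_assoc]⟩
  rcases hq.dvd_or_dvd hab with h | h
  · left
    rw [← hu.dvd_mul_left, ← ha']
    exact hpq.trans (map_dvd ι h)
  · right
    rw [← hu.dvd_mul_left, ← hb']
    exact hpq.trans (map_dvd ι h)

/-- The group algebra over a field of a torsion-free abelian group with the ascending chain
condition on cyclic subgroups is factorial. -/
theorem uniqueFactorizationMonoid_groupAlgebra (K : Type*) [Field K]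
    (hG : ACCOnCyclicSubgroups G) : UniqueFactorizationMonoid (AddMonoidAlgebra K G) :=
  have := wfDvdMonoid_groupAlgebra K hG
  { irreducible_iff_prime := ⟨prime_of_irreducible_groupAlgebra, Prime.irreducible⟩ }

end Factorial

/-! ### Height-one primes and divisibility tests; factorial domains. -/

section HeightOne

variable {R : Type*} [CommRing R] [IsDomain R]

theorem mem_heightOneSpectrum_iff {P : Ideal R} :
    P ∈ heightOneSpectrum R ↔
      P.IsPrime ∧ P ≠ ⊥ ∧ ∀ Q : Ideal R, Q.IsPrime → Q < P → Q = ⊥ := by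
  constructor
  · rintro ⟨hP, h⟩
    refine ⟨hP, fun h0 => ?_, fun Q hQ hlt => ?_⟩
    · rw [Ideal.height_eq_zero_iff_eq_bot.2 h0] at h
      exact zero_ne_one h
    · have := (Ideal.height_le_iff (p := P) (n := 1)).1 h.le Q hQ hlt
      rw [← Ideal.height_eq_zero_iff_eq_bot]
      exact Order.lt_one_iff.1 this
  · rintro ⟨hP, h0, h⟩
    refine ⟨hP, le_antisymm ?_ ?_⟩
    · refine (Ideal.height_le_iff (p := P) (n := 1)).2 fun Q hQ hlt => ?_
      rw [Ideal.height_eq_zero_iff_eq_bot.2 (h Q hQ hlt)]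
      exact zero_lt_one
    · rw [Order.one_le_iff_ne_zero, Ne, Ideal.height_eq_zero_iff_eq_bot]
      exact h0

theorem eq_of_le_of_mem_heightOneSpectrum {P Q : Ideal R} (hP : P ∈ heightOneSpectrum R)
    (hQ : Q.IsPrime) (h0 : Q ≠ ⊥) (hle : Q ≤ P) : Q = P := by
  by_contra hne
  exact h0 ((mem_heightOneSpectrum_iff.1 hP).2.2 Q hQ (lt_of_le_of_ne hle hne))

/-- A domain is the intersection of its localizations at height-one primes exactly if divisibility
can be tested at these primes. -/
theorem iInf_localization_eq_bot_iff :
    (⨅ (P : PrimeSpectrum R) (_ : P.asIdeal ∈ heightOneSpectrum R),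
      Localization.subalgebra.ofField (FractionRing R) P.asIdeal.primeCompl
        P.asIdeal.primeCompl_le_nonZeroDivisors) = (⊥ : Subalgebra R (FractionRing R)) ↔
    ∀ a b : R, b ≠ 0 → (∀ P ∈ heightOneSpectrum R, ∃ s ∉ P, b ∣ s * a) → b ∣ a := by
  set φ := algebraMap R (FractionRing R)
  have hφ : Function.Injective φ := IsFractionRing.injective R (FractionRing R)
  have hφ0 {x : R} (hx : x ≠ 0) : φ x ≠ 0 := (map_ne_zero_iff φ hφ).2 hx
  have hmem (P : PrimeSpectrum R) (x : FractionRing R) :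
      x ∈ Localization.subalgebra.ofField (FractionRing R) P.asIdeal.primeCompl
        P.asIdeal.primeCompl_le_nonZeroDivisors ↔
      ∃ (a s : R) (_ : s ∈ P.asIdeal.primeCompl), x = φ a * (φ s)⁻¹ := Iff.rfl
  constructor
  · intro h a b hb hab
    have hx : φ a * (φ b)⁻¹ ∈ (⊥ : Subalgebra R (FractionRing R)) := by
      rw [← h]
      simp only [Algebra.mem_iInf]
      intro P hP
      obtain ⟨s, hs, c, hc⟩ := hab _ hP
      have hs0 : s ≠ 0 := by rintro rfl; exact hs P.asIdeal.zero_mem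
      refine (hmem P _).2 ⟨c, s, hs, ?_⟩
      rw [← div_eq_mul_inv, ← div_eq_mul_inv, div_eq_div_iff (hφ0 hb) (hφ0 hs0), ← map_mul,
        ← map_mul, mul_comm a, hc, mul_comm]
    obtain ⟨c, hc⟩ := Algebra.mem_bot.1 hx
    refine ⟨c, hφ ?_⟩
    rw [map_mul, mul_comm, eq_comm, ← eq_mul_inv_iff_mul_eq₀ (hφ0 hb)]
    exact hc
  · intro h
    refine eq_bot_iff.2 fun x hx => ?_
    simp only [Algebra.mem_iInf] at hx
    obtain ⟨a, b, hb, rfl⟩ := IsFractionRing.div_surjective (A := R) x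
    have hb0 := nonZeroDivisors.ne_zero hb
    obtain ⟨c, rfl⟩ := h a b hb0 fun P hP => by
      obtain ⟨c, s, hs, e⟩ := (hmem ⟨P, hP.1⟩ _).1 (hx ⟨P, hP.1⟩ hP)
      have hs0 : s ≠ 0 := by rintro rfl; exact hs P.zero_mem
      refine ⟨s, hs, c, hφ ?_⟩
      rw [← div_eq_mul_inv, div_eq_div_iff (hφ0 hb0) (hφ0 hs0), ← map_mul, ← map_mul] at e
      rw [mul_comm s, e, mul_comm]
    refine Algebra.mem_bot.2 ⟨c, ?_⟩
    rw [map_mul, mul_div_cancel_left₀ _ (hφ0 hb0)]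

theorem isWeaklyKrull_iff : IsWeaklyKrull R ↔
    (∀ a b : R, b ≠ 0 → (∀ P ∈ heightOneSpectrum R, ∃ s ∉ P, b ∣ s * a) → b ∣ a) ∧
    ∀ x : R, x ≠ 0 → ¬ IsUnit x → {P ∈ heightOneSpectrum R | x ∈ P}.Finite := by
  rw [← iInf_localization_eq_bot_iff]
  exact ⟨fun h => ⟨h.1, h.2⟩, fun h => ⟨h.1, h.2⟩⟩

theorem span_prime_mem_heightOneSpectrum [UniqueFactorizationMonoid R] {p : R} (hp : Prime p) :
    Ideal.span {p} ∈ heightOneSpectrum R := by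
  rw [mem_heightOneSpectrum_iff]
  refine ⟨(Ideal.span_singleton_prime hp.ne_zero).2 hp, ?_, fun Q hQ hlt => ?_⟩
  · rw [Ne, Ideal.span_singleton_eq_bot]
    exact hp.ne_zero
  · by_contra h0
    obtain ⟨q, hqQ, hq⟩ := hQ.exists_mem_prime_of_ne_bot h0
    have hpq : p ∣ q := Ideal.mem_span_singleton.1 (hlt.le hqQ)
    have hqp : q ∣ p := ((hp.irreducible.dvd_irreducible_iff_associated hq.irreducible).1 hpq).dvd'
    exact hlt.not_ge ((Ideal.span_singleton_le_iff_mem Q).2 (Q.mem_of_dvd hqp hqQ))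

/-- A factorial domain is weakly Krull. -/
theorem isWeaklyKrull_of_uniqueFactorizationMonoid [UniqueFactorizationMonoid R] :
    IsWeaklyKrull R := by
  classical
  refine isWeaklyKrull_iff.2 ⟨fun a b hb => ?_, fun x hx _ => ?_⟩
  · induction b using UniqueFactorizationMonoid.induction_on_prime generalizing a with
    | h₁ => exact absurd rfl hb
    | h₂ u hu => exact fun _ => hu.dvd
    | h₃ b p hb0 hp ih =>
      intro h
      obtain ⟨c, rfl⟩ := ih a hb0 fun P hP => by
        obtain ⟨s, hs, hd⟩ := h P hP
        exact ⟨s, hs, (dvd_mul_left b p).trans hd⟩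
      -- At the prime `(p)`, cancelling `b` leaves `p ∣ s * c` with `p ∤ s`.
      obtain ⟨s, hs, hd⟩ := h _ (span_prime_mem_heightOneSpectrum hp)
      rw [Ideal.mem_span_singleton] at hs
      rw [mul_left_comm s, mul_comm p] at hd
      rw [mul_comm p]
      exact mul_dvd_mul_left b
        ((hp.dvd_or_dvd ((mul_dvd_mul_iff_left hb0).1 hd)).resolve_left hs)
  · refine ((UniqueFactorizationMonoid.factors x).toFinset.finite_toSet.image
      fun p => Ideal.span {p}).subset ?_
    rintro P ⟨hP, hxP⟩
    have hPp := hP.1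
    have hmem : (UniqueFactorizationMonoid.factors x).prod ∈ P :=
      P.mem_of_dvd (UniqueFactorizationMonoid.factors_prod hx).dvd' hxP
    obtain ⟨p, hp, hpP⟩ := (Ideal.IsPrime.multiset_prod_mem_iff_exists_mem hPp _).1 hmem
    have hpp := UniqueFactorizationMonoid.prime_of_factor p hp
    refine ⟨p, by simpa using hp, ?_⟩
    exact eq_of_le_of_mem_heightOneSpectrum hP ((Ideal.span_singleton_prime hpp.ne_zero).2 hpp)
      (by rw [Ne, Ideal.span_singleton_eq_bot]; exact hpp.ne_zero)
      ((Ideal.span_singleton_le_iff_mem P).2 hpP)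

end HeightOne

/-! ### Localization at a height-one prime, without denominators. -/

section Localization

variable {D : Type*} [CommRing D]

/-- In the localization of a domain at a height-one prime `P`, every element of `P` is nilpotent
modulo any nonzero element. -/
theorem exists_dvd_mul_pow [IsDomain D] {P : Ideal D} (hP : P ∈ heightOneSpectrum D) {b p : D}
    (hb : b ≠ 0) (hp : p ∈ P) : ∃ N : ℕ, ∃ t ∉ P, b ∣ t * p ^ N := by
  have := hP.1
  by_contra! h
  -- If no such power existed, some prime `Q` over `b` would avoid both `p` and the complement of
  -- `P`; being nonzero inside `P`, it would equal `P`, which contains `p`.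
  obtain ⟨Q, hQ, hle, hdisj⟩ := Ideal.exists_le_prime_disjoint (Ideal.span {b})
    (P.primeCompl ⊔ Submonoid.powers p) (by
      rw [Set.disjoint_left]
      intro x hx hx'
      obtain ⟨t, ht, y, ⟨N, rfl⟩, rfl⟩ := Submonoid.mem_sup.1 hx'
      exact h N t ht (Ideal.mem_span_singleton.1 hx))
  rw [Set.disjoint_left] at hdisj
  have hbQ : b ∈ Q := hle (Ideal.mem_span_singleton_self b)
  have hQP : Q ≤ P := fun x hx => by
    by_contra hxP
    exact hdisj hx (Submonoid.mem_sup_left (S := P.primeCompl) hxP)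
  have hpQ : p ∉ Q := fun h => hdisj h (Submonoid.mem_sup_right (Submonoid.mem_powers p))
  have := eq_of_le_of_mem_heightOneSpectrum hP hQ (by rintro rfl; exact hb hbQ) hQP
  exact hpQ (this ▸ hp)

/-- The saturation of the principal ideal `(b)` with respect to the complement of a prime `P`. -/
def saturation (P : Ideal D) [P.IsPrime] (b : D) : Ideal D where
  carrier := {x | ∃ t ∉ P, b ∣ t * x}
  zero_mem' := ⟨1, fun h => Ideal.IsPrime.ne_top' ((Ideal.eq_top_iff_one P).2 h), by simp⟩
  add_mem' := by
    rintro x y ⟨t, ht, hx⟩ ⟨u, hu, hy⟩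
    refine ⟨t * u, fun h => (Ideal.IsPrime.mem_or_mem ‹_› h).elim ht hu, ?_⟩
    rw [mul_add]
    refine dvd_add ?_ ?_
    · rw [mul_right_comm]; exact hx.mul_right u
    · rw [mul_assoc]; exact hy.mul_left t
  smul_mem' := by
    rintro c x ⟨t, ht, hx⟩
    refine ⟨t, ht, ?_⟩
    rw [smul_eq_mul, mul_left_comm]
    exact hx.mul_left c

theorem mem_saturation_of_mul_mem {P : Ideal D} [P.IsPrime] {b x y : D} (hx : x ∉ P)
    (h : x * y ∈ saturation P b) : y ∈ saturation P b := by
  obtain ⟨t, ht, hd⟩ := h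
  refine ⟨t * x, fun h => (Ideal.IsPrime.mem_or_mem ‹_› h).elim ht hx, ?_⟩
  rwa [mul_assoc]

theorem exists_common_multiplier {P : Ideal D} [P.IsPrime] {b : D} {ι : Type*} (s : Finset ι)
    (f : ι → D) (h : ∀ i ∈ s, f i ∈ saturation P b) : ∃ t ∉ P, ∀ i ∈ s, b ∣ t * f i := by
  classical
  choose! t ht hd using h
  refine ⟨∏ i ∈ s, t i, fun hmem => ?_, fun i hi => ?_⟩
  · obtain ⟨i, hi, hi'⟩ := (Ideal.IsPrime.prod_mem_iff).1 hmem
    exact ht i hi hi'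
  · exact (hd i hi).trans (mul_dvd_mul_right (Finset.dvd_prod_of_mem t hi) _)

end Localization

/-! ### The ideals `P[G]` and nonzerodivisors modulo a constant. -/

section CoefficientIdeals

variable {D : Type*} [CommRing D] {G : Type*} [AddCommGroup G]

theorem mem_coeffIdeal {P : Ideal D} {f : AddMonoidAlgebra D G} :
    f ∈ coeffIdeal G P ↔ ∀ x, f.coeff x ∈ P := Iff.rfl

/-- The constant elements of a group algebra. -/
noncomputable def constHom (D : Type*) [CommRing D] (G : Type*) [AddCommGroup G] :
    D →+* AddMonoidAlgebra D G := AddMonoidAlgebra.singleZeroRingHom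

theorem constHom_apply (d : D) : constHom D G d = AddMonoidAlgebra.single 0 d := rfl

theorem coeff_constHom_mul (d : D) (f : AddMonoidAlgebra D G) (x : G) :
    (constHom D G d * f).coeff x = d * f.coeff x := by
  rw [constHom_apply, AddMonoidAlgebra.coeff_single_zero_mul]

theorem coeff_constHom_zero (d : D) : (constHom D G d).coeff 0 = d := by
  rw [constHom_apply, AddMonoidAlgebra.coeff_single, Finsupp.single_eq_same]

theorem constHom_injective : Function.Injective (constHom D G) := fun a b h => by
  rw [← coeff_constHom_zero (G := G) a, h, coeff_constHom_zero]

theorem single_eq_mul_constHom (x : G) (d : D) :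
    AddMonoidAlgebra.single x d = AddMonoidAlgebra.single x 1 * constHom D G d := by
  rw [constHom_apply, AddMonoidAlgebra.single_mul_single, add_zero, one_mul]

theorem constHom_dvd_iff {d : D} {f : AddMonoidAlgebra D G} :
    constHom D G d ∣ f ↔ ∀ x, d ∣ f.coeff x := by
  constructor
  · rintro ⟨g, rfl⟩ x
    rw [coeff_constHom_mul]
    exact dvd_mul_right _ _
  · intro h
    rw [← AddMonoidAlgebra.sum_coeff_single f]
    refine Finset.dvd_sum fun x _ => ?_
    rw [single_eq_mul_constHom]
    exact (map_dvd _ (h x)).mul_left _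

theorem constHom_dvd_constHom {d e : D} : constHom D G d ∣ constHom D G e ↔ d ∣ e := by
  refine ⟨fun h => ?_, fun h => map_dvd _ h⟩
  have := constHom_dvd_iff.1 h 0
  rwa [coeff_constHom_zero] at this

theorem constHom_mem_coeffIdeal {P : Ideal D} {d : D} :
    constHom D G d ∈ coeffIdeal G P ↔ d ∈ P := by
  classical
  refine ⟨fun h => by simpa only [coeff_constHom_zero] using h 0, fun h x => ?_⟩
  rw [constHom_apply, AddMonoidAlgebra.coeff_single, Finsupp.single_apply]
  split_ifs
  exacts [h, P.zero_mem]

theorem coeffIdeal_le_iff {P Q : Ideal D} : coeffIdeal G P ≤ coeffIdeal G Q ↔ P ≤ Q :=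
  ⟨fun h _ hx => constHom_mem_coeffIdeal.1 (h (constHom_mem_coeffIdeal.2 hx)),
    fun h _ hf x => h (hf x)⟩

theorem coeffIdeal_injective : Function.Injective (coeffIdeal G : Ideal D → _) := fun _ _ h =>
  le_antisymm (coeffIdeal_le_iff.1 h.le) (coeffIdeal_le_iff.1 h.ge)

theorem coeffIdeal_ne_bot {P : Ideal D} (hP : P ≠ ⊥) : coeffIdeal G P ≠ ⊥ := by
  obtain ⟨d, hd, hd0⟩ := Submodule.exists_mem_ne_zero_of_ne_bot hP
  intro h
  have : constHom D G d ∈ coeffIdeal G P := constHom_mem_coeffIdeal.2 hd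
  rw [h, Ideal.mem_bot, map_eq_zero_iff _ constHom_injective] at this
  exact hd0 this

theorem coeffIdeal_comap_le (A : Ideal (AddMonoidAlgebra D G)) :
    coeffIdeal G (A.comap (constHom D G)) ≤ A := by
  intro f hf
  rw [← AddMonoidAlgebra.sum_coeff_single f]
  refine A.sum_mem fun x _ => ?_
  rw [single_eq_mul_constHom]
  exact A.mul_mem_left _ (hf x)

variable [IsAddTorsionFree G]

/-- It is the kernel of the map to `(D/P)[G]`, a domain. -/
theorem coeffIdeal_isPrime (P : Ideal D) [P.IsPrime] : (coeffIdeal G P).IsPrime := by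
  have h : coeffIdeal G P = RingHom.ker (AddMonoidAlgebra.mapRingHom G (Ideal.Quotient.mk P)) := by
    ext f
    rw [RingHom.mem_ker, mem_coeffIdeal, ← AddMonoidAlgebra.coeff_inj, DFunLike.ext_iff]
    simp [Ideal.Quotient.eq_zero_iff_mem]
  rw [h]
  exact RingHom.ker_isPrime _

/-- An element all of whose nonzero coefficients lie outside `P` is a nonzerodivisor modulo the
ideal of elements with coefficients in a `P`-saturated ideal. -/
theorem mem_coeffIdeal_saturation_of_mul_mem {P : Ideal D} [P.IsPrime] {b : D}
    {s g : AddMonoidAlgebra D G} (hs0 : s ≠ 0) (hs : ∀ x ∈ s.coeff.support, s.coeff x ∉ P)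
    (h : s * g ∈ coeffIdeal G (saturation P b)) : g ∈ coeffIdeal G (saturation P b) := by
  classical
  have := twoUniqueSums_of_torsionFree G
  set I := saturation P b
  -- Discarding the coefficients of `g` already in `I` changes nothing modulo `I[G]`. If anything
  -- remained, a unique sum would give a coefficient of `s * g₁` that is a single product, outside
  -- `I`.
  let g₁ : AddMonoidAlgebra D G := .ofCoeff (g.coeff.filter fun x => g.coeff x ∉ I)
  have hg₁ (x : G) : g₁.coeff x = if g.coeff x ∈ I then 0 else g.coeff x :=
    (Finsupp.filter_apply ..).trans (ite_not ..)
  have hsub : g - g₁ ∈ coeffIdeal G I := fun x => by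
    rw [AddMonoidAlgebra.coeff_sub, Finsupp.sub_apply, hg₁]
    split_ifs with hx
    · rwa [sub_zero]
    · rw [sub_self]; exact I.zero_mem
  by_cases h0 : g₁ = 0
  · rwa [h0, sub_zero] at hsub
  have hmul : s * g₁ ∈ coeffIdeal G I := by
    have := sub_mem h ((coeffIdeal G I).mul_mem_left s hsub)
    rwa [mul_sub, sub_sub_cancel] at this
  obtain ⟨x, hx, y, hy, hu⟩ := UniqueSums.uniqueAdd_of_nonempty (support_nonempty_of_ne_zero hs0)
    (support_nonempty_of_ne_zero h0)
  have hxy := hmul (x + y)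
  rw [AddMonoidAlgebra.coeff_mul_add_of_uniqueAdd hu] at hxy
  have hyI := mem_saturation_of_mul_mem (hs x hx) hxy
  rw [Finsupp.mem_support_iff] at hy
  rw [hg₁] at hy hyI
  split_ifs at hy hyI with hc
  · exact absurd rfl hy
  · exact absurd hyI hc

/-- For a height-one prime `P`, an element outside `P[G]` is a nonzerodivisor modulo `b D_P[G]`. -/
theorem exists_constHom_dvd [IsDomain D] {P : Ideal D} (hP : P ∈ heightOneSpectrum D) {b : D}
    (hb : b ≠ 0) {s g : AddMonoidAlgebra D G} (hs : s ∉ coeffIdeal G P)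
    (h : constHom D G b ∣ s * g) : ∃ t ∉ P, constHom D G b ∣ constHom D G t * g := by
  classical
  have := hP.1
  set J := coeffIdeal G (saturation P b)
  have hsg : s * g ∈ J := fun x => by
    refine ⟨1, fun h1 => this.ne_top ((Ideal.eq_top_iff_one P).2 h1), ?_⟩
    rw [one_mul]
    exact constHom_dvd_iff.1 h x
  let s' : AddMonoidAlgebra D G := .ofCoeff (s.coeff.filter fun x => s.coeff x ∉ P)
  have hs' (x : G) : s'.coeff x = if s.coeff x ∈ P then 0 else s.coeff x :=
    (Finsupp.filter_apply ..).trans (ite_not ..)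
  -- The discarded coefficients lie in `P`, hence are nilpotent modulo `b` in `D_P`.
  have hn : s - s' ∈ J.radical := by
    rw [← AddMonoidAlgebra.sum_coeff_single (s - s')]
    refine Ideal.sum_mem _ fun x _ => ?_
    have hxP : (s - s').coeff x ∈ P := by
      rw [AddMonoidAlgebra.coeff_sub, Finsupp.sub_apply, hs']
      split_ifs with hx
      · rwa [sub_zero]
      · rw [sub_self]; exact P.zero_mem
    rw [single_eq_mul_constHom]
    refine Ideal.mul_mem_left _ _ ?_
    obtain ⟨N, hN⟩ := exists_dvd_mul_pow hP hb hxP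
    refine ⟨N, ?_⟩
    rw [← map_pow]
    exact constHom_mem_coeffIdeal.2 hN
  have hs'0 : s' ≠ 0 := by
    intro h0
    refine hs fun x => ?_
    by_contra hx
    have hx' := hs' x
    rw [if_neg hx, h0] at hx'
    exact hx (hx' ▸ P.zero_mem)
  have hs'P : ∀ x ∈ s'.coeff.support, s'.coeff x ∉ P := by
    intro x hx
    rw [Finsupp.mem_support_iff] at hx
    rw [hs'] at hx ⊢
    split_ifs at hx ⊢ with hc
    · exact absurd rfl hx
    · exact hc
  obtain ⟨N, hN⟩ := hn
  -- Since `s` divides `s' ^ N - (s' - s) ^ N`, a power of `s'` replaces `s`; its factors are then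
  -- cancelled one by one.
  have hpow : s' ^ N * g ∈ J := by
    have h1 : s ∣ s' ^ N - (s' - s) ^ N := by
      simpa using sub_dvd_pow_sub_pow s' (s' - s) N
    obtain ⟨k, hk⟩ := h1
    have h2 : (s' - s) ^ N ∈ J := by
      rw [← neg_sub, neg_pow]
      exact J.mul_mem_left _ hN
    have h3 : s' ^ N * g = k * (s * g) + g * (s' - s) ^ N := by linear_combination g * hk
    rw [h3]
    exact J.add_mem (J.mul_mem_left _ hsg) (J.mul_mem_left _ h2)
  have hg : g ∈ J := by
    clear hN
    induction N with
    | zero => simpa using hpow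
    | succ n ih =>
      refine ih (mem_coeffIdeal_saturation_of_mul_mem hs'0 hs'P ?_)
      rwa [← mul_assoc, ← pow_succ']
  obtain ⟨t, ht, hd⟩ := exists_common_multiplier g.coeff.support g.coeff fun x _ => hg x
  refine ⟨t, ht, constHom_dvd_iff.2 fun x => ?_⟩
  rw [coeff_constHom_mul]
  by_cases hx : x ∈ g.coeff.support
  · exact hd x hx
  · rw [Finsupp.notMem_support_iff.1 hx, mul_zero]
    exact dvd_zero b

end CoefficientIdeals

/-! ### Passage to `K[G]` and the classification of height-one primes. -/

section FractionField

variable (D : Type*) [CommRing D] (G : Type*) [AddCommGroup G]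

/-- The extension of coefficients `D[G] →+* K[G]` to the quotient field `K` of `D`. -/
noncomputable def toFractionAlgebra :
    AddMonoidAlgebra D G →+* AddMonoidAlgebra (FractionRing D) G :=
  AddMonoidAlgebra.mapRingHom G (algebraMap D (FractionRing D))

theorem toFractionAlgebra_injective : Function.Injective (toFractionAlgebra D G) :=
  AddMonoidAlgebra.map_injective _ (IsFractionRing.injective D (FractionRing D))

/-- `K[G]` is the localization of `D[G]` at the nonzero constants. -/
theorem isLocalization_toFractionAlgebra :
    @IsLocalization _ _ ((nonZeroDivisors D).map (constHom D G))
      (AddMonoidAlgebra (FractionRing D) G) _ (toFractionAlgebra D G).toAlgebra := by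
  let _ := (toFractionAlgebra D G).toAlgebra
  have hconst (d : D) : toFractionAlgebra D G (constHom D G d) =
      constHom (FractionRing D) G (algebraMap D (FractionRing D) d) :=
    AddMonoidAlgebra.mapRingHom_single _ _ _
  rw [isLocalization_iff]
  refine ⟨?_, fun g => ?_, fun {x y} h => ⟨1, by rw [toFractionAlgebra_injective D G h]⟩⟩
  · rintro ⟨_, d, hd, rfl⟩
    change IsUnit (toFractionAlgebra D G (constHom D G d))
    rw [hconst]
    exact (IsLocalization.map_units (FractionRing D) (⟨d, hd⟩ : nonZeroDivisors D)).map _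
  · classical
    obtain ⟨d, hd⟩ := IsLocalization.exist_integer_multiples_of_finset (nonZeroDivisors D)
      (g.coeff.support.image g.coeff)
    have hrange : constHom (FractionRing D) G (algebraMap D (FractionRing D) d) * g ∈
        Set.range (AddMonoidAlgebra.map (M := G)
          (algebraMap D (FractionRing D) : D →+ FractionRing D)) := by
      rw [AddMonoidAlgebra.range_map]
      intro x
      rw [coeff_constHom_mul]
      by_cases hx : x ∈ g.coeff.support
      · obtain ⟨c, hc⟩ := hd _ (Finset.mem_image_of_mem _ hx)
        refine ⟨c, ?_⟩
        rw [Algebra.smul_def] at hc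
        exact hc
      · rw [Finsupp.notMem_support_iff.1 hx, mul_zero]
        exact ⟨0, map_zero _⟩
    obtain ⟨f, hf⟩ := hrange
    refine ⟨⟨f, ⟨constHom D G d, d, d.2, rfl⟩⟩, ?_⟩
    change g * toFractionAlgebra D G (constHom D G d) = toFractionAlgebra D G f
    rw [hconst, mul_comm]
    exact hf.symm

variable {D G}

theorem comap_mem_heightOneSpectrum {Q : Ideal (AddMonoidAlgebra (FractionRing D) G)}
    (hQ : Q ∈ heightOneSpectrum (AddMonoidAlgebra (FractionRing D) G)) :
    Q.comap (toFractionAlgebra D G) ∈ heightOneSpectrum (AddMonoidAlgebra D G) := by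
  let _ := (toFractionAlgebra D G).toAlgebra
  have := isLocalization_toFractionAlgebra D G
  have := hQ.1
  exact ⟨Ideal.IsPrime.comap _,
    (IsLocalization.height_under ((nonZeroDivisors D).map (constHom D G)) Q).trans hQ.2⟩

variable [IsDomain D]

theorem exists_mul_constHom_eq (g : AddMonoidAlgebra (FractionRing D) G) :
    ∃ (d : D) (f : AddMonoidAlgebra D G), d ≠ 0 ∧
      g * toFractionAlgebra D G (constHom D G d) = toFractionAlgebra D G f := by
  let _ := (toFractionAlgebra D G).toAlgebra
  have := isLocalization_toFractionAlgebra D G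
  obtain ⟨⟨f, ⟨_, d, hd, rfl⟩⟩, h⟩ :=
    IsLocalization.surj ((nonZeroDivisors D).map (constHom D G)) g
  exact ⟨d, f, nonZeroDivisors.ne_zero hd, h⟩

theorem exists_eq_comap {A : Ideal (AddMonoidAlgebra D G)}
    (hA : A ∈ heightOneSpectrum (AddMonoidAlgebra D G))
    (h0 : ∀ d : D, constHom D G d ∈ A → d = 0) :
    ∃ Q ∈ heightOneSpectrum (AddMonoidAlgebra (FractionRing D) G),
      A = Q.comap (toFractionAlgebra D G) := by
  let _ := (toFractionAlgebra D G).toAlgebra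
  have := isLocalization_toFractionAlgebra D G
  have := hA.1
  have hdisj : Disjoint (((nonZeroDivisors D).map (constHom D G) : Submonoid _) :
      Set (AddMonoidAlgebra D G)) (A : Set (AddMonoidAlgebra D G)) := by
    rw [Set.disjoint_left]
    rintro _ ⟨d, hd, rfl⟩ hdA
    exact nonZeroDivisors.ne_zero hd (h0 d hdA)
  refine ⟨A.map (algebraMap _ _), ⟨IsLocalization.isPrime_of_isPrime_disjoint
    ((nonZeroDivisors D).map (constHom D G)) _ A hA.1 hdisj, ?_⟩,
    (IsLocalization.under_map_of_isPrime_disjoint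
      ((nonZeroDivisors D).map (constHom D G)) _ hA.1 hdisj).symm⟩
  rw [IsLocalization.height_map_of_disjoint ((nonZeroDivisors D).map (constHom D G)) A hdisj]
  exact hA.2

variable [IsAddTorsionFree G]

/-- With `P = A ∩ D` nonzero, `P[G]` is a nonzero prime inside `A`, hence equal to it. A nonzero
prime `Q < P` would likewise give `Q[G] = A`. -/
theorem exists_eq_coeffIdeal {A : Ideal (AddMonoidAlgebra D G)}
    (hA : A ∈ heightOneSpectrum (AddMonoidAlgebra D G)) {d : D} (hd : d ≠ 0)
    (hdA : constHom D G d ∈ A) : ∃ P ∈ heightOneSpectrum D, A = coeffIdeal G P := by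
  have := hA.1
  set P := A.comap (constHom D G) with hPdef
  have hP0 : P ≠ ⊥ := fun h => hd ((Ideal.mem_bot (R := D)).1 (h ▸ (show d ∈ P from hdA)))
  have heq : coeffIdeal G P = A := eq_of_le_of_mem_heightOneSpectrum hA (coeffIdeal_isPrime P)
    (coeffIdeal_ne_bot hP0) (coeffIdeal_comap_le A)
  refine ⟨P, mem_heightOneSpectrum_iff.2 ⟨inferInstance, hP0, fun Q hQ hlt => ?_⟩, heq.symm⟩
  by_contra hQ0
  have := eq_of_le_of_mem_heightOneSpectrum hA (coeffIdeal_isPrime Q) (coeffIdeal_ne_bot hQ0)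
    (heq ▸ coeffIdeal_le_iff.2 hlt.le)
  exact hlt.ne (coeffIdeal_injective (this.trans heq.symm))

theorem isMonoidUMT_iff : IsMonoidUMT D G ↔
    ∀ P ∈ heightOneSpectrum D, coeffIdeal G P ∈ heightOneSpectrum (AddMonoidAlgebra D G) := by
  constructor
  · intro h P hP
    rw [IsMonoidUMT] at h
    rw [h]
    exact Or.inl ⟨P, hP, rfl⟩
  · intro h
    refine Set.Subset.antisymm (fun A hA => ?_) ?_
    · by_cases h0 : ∀ d : D, constHom D G d ∈ A → d = 0
      · exact Or.inr (exists_eq_comap hA h0)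
      · push Not at h0
        obtain ⟨d, hdA, hd⟩ := h0
        exact Or.inl (exists_eq_coeffIdeal hA hd hdA)
    · rintro A (⟨P, hP, rfl⟩ | ⟨Q, hQ, rfl⟩)
      · exact h P hP
      · exact comap_mem_heightOneSpectrum hQ

end FractionField

/-! ### Transfer of the weakly Krull property. -/

section WeaklyKrull

theorem IsWeaklyKrull.finite_of_ne_zero {R : Type*} [CommRing R] [IsDomain R]
    (h : IsWeaklyKrull R) {x : R} (hx : x ≠ 0) : {P ∈ heightOneSpectrum R | x ∈ P}.Finite := by
  by_cases hu : IsUnit x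
  · refine Set.finite_empty.subset ?_
    rintro P ⟨hP, hxP⟩
    exact hP.1.ne_top (P.eq_top_of_isUnit_mem hxP hu)
  · exact h.finite_character x hx hu

variable {D : Type*} [CommRing D] [IsDomain D] {G : Type*} [AddCommGroup G] [IsAddTorsionFree G]

theorem coeffIdeal_mem_heightOneSpectrum (h : IsWeaklyKrull (AddMonoidAlgebra D G)) {P : Ideal D}
    (hP : P ∈ heightOneSpectrum D) :
    coeffIdeal G P ∈ heightOneSpectrum (AddMonoidAlgebra D G) := by
  classical
  have hprime := hP.1
  obtain ⟨a, ha, ha0⟩ := Submodule.exists_mem_ne_zero_of_ne_bot (mem_heightOneSpectrum_iff.1 hP).2.1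
  have hC0 : constHom D G a ≠ 0 := (map_ne_zero_iff _ constHom_injective).2 ha0
  by_contra hcon
  have hfin := h.finite_of_ne_zero hC0
  have hb (A : Ideal (AddMonoidAlgebra D G)) (hA : A ∈ hfin.toFinset) :
      ∃ b ∉ P, constHom D G b ∈ A := by
    rw [Set.Finite.mem_toFinset] at hA
    have := hA.1.1
    -- If `A ∩ D ⊆ P`, then `A ∩ D = P` because it contains `a ≠ 0`; so `P[G] ⊆ A`, hence `P[G] = A`
    -- has height one.
    by_contra! hle
    have hAP : A.comap (constHom D G) = P := eq_of_le_of_mem_heightOneSpectrum hP inferInstance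
      (fun h0 => ha0 ((Ideal.mem_bot (R := D)).1
        (h0 ▸ (show a ∈ A.comap (constHom D G) from hA.2))))
      fun b hbA => by
        by_contra hbP
        exact hle b hbP hbA
    have := eq_of_le_of_mem_heightOneSpectrum hA.1 (coeffIdeal_isPrime P)
      (coeffIdeal_ne_bot (mem_heightOneSpectrum_iff.1 hP).2.1) (hAP ▸ coeffIdeal_comap_le A)
    exact hcon (this ▸ hA.1)
  choose! b hbP hbA using hb
  set β := ∏ A ∈ hfin.toFinset, b A
  have hβP : β ∉ P := fun hmem => by
    obtain ⟨A, hA, hA'⟩ := Ideal.IsPrime.prod_mem_iff.1 hmem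
    exact hbP A hA hA'
  have hloc (A : Ideal (AddMonoidAlgebra D G)) (hA : A ∈ hfin.toFinset) :
      ∃ N : ℕ, ∃ t ∉ A, constHom D G a ∣ t * constHom D G β ^ N := by
    have hAm := (hfin.mem_toFinset.1 hA).1
    exact exists_dvd_mul_pow hAm hC0 (A.mem_of_dvd (map_dvd _ (Finset.dvd_prod_of_mem b hA))
      (hbA A hA))
  choose! N t htA hdvd using hloc
  -- Now `β` lies in every height-one prime over `a`, so `a` divides a power of `β` locally there;
  -- at other primes `a` is a unit.
  have hdiv : constHom D G a ∣ constHom D G β ^ ∑ A ∈ hfin.toFinset, N A := by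
    refine (isWeaklyKrull_iff.1 h).1 _ _ hC0 fun A hA => ?_
    by_cases haA : constHom D G a ∈ A
    · have hAm := hfin.mem_toFinset.2 ⟨hA, haA⟩
      exact ⟨t A, htA A hAm, (hdvd A hAm).trans (mul_dvd_mul_left _
        (pow_dvd_pow _ (Finset.single_le_sum (fun _ _ => Nat.zero_le _) hAm)))⟩
    · exact ⟨constHom D G a, haA, dvd_mul_right _ _⟩
  rw [← map_pow, constHom_dvd_constHom] at hdiv
  exact hβP (hprime.mem_of_pow_mem _ (P.mem_of_dvd hdiv ha))

theorem isWeaklyKrull_of_groupAlgebra (h : IsWeaklyKrull (AddMonoidAlgebra D G)) :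
    IsWeaklyKrull D := by
  refine isWeaklyKrull_iff.2 ⟨fun a b hb hab => ?_, fun x hx _ => ?_⟩
  · rw [← constHom_dvd_constHom (G := G)]
    refine (isWeaklyKrull_iff.1 h).1 _ _ ((map_ne_zero_iff _ constHom_injective).2 hb)
      fun A hA => ?_
    by_cases hbA : constHom D G b ∈ A
    · obtain ⟨P, hP, rfl⟩ := exists_eq_coeffIdeal hA hb hbA
      obtain ⟨s, hs, hd⟩ := hab P hP
      refine ⟨constHom D G s, fun hmem => hs (constHom_mem_coeffIdeal.1 hmem), ?_⟩
      rw [← map_mul]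
      exact map_dvd _ hd
    · exact ⟨constHom D G b, hbA, dvd_mul_right _ _⟩
  · refine Set.Finite.of_injOn (f := coeffIdeal G) (fun P hP => ?_) coeffIdeal_injective.injOn
      (h.finite_of_ne_zero ((map_ne_zero_iff _ (constHom_injective (G := G))).2 hx))
    exact ⟨coeffIdeal_mem_heightOneSpectrum h hP.1, constHom_mem_coeffIdeal.2 hP.2⟩

theorem isWeaklyKrull_groupAlgebra (hK : IsWeaklyKrull (AddMonoidAlgebra (FractionRing D) G))
    (hD : IsWeaklyKrull D) (hU : IsMonoidUMT D G) : IsWeaklyKrull (AddMonoidAlgebra D G) := by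
  have hinj := toFractionAlgebra_injective D G
  have hUMT := isMonoidUMT_iff.1 hU
  refine isWeaklyKrull_iff.2 ⟨fun a b hb hab => ?_, fun x hx _ => ?_⟩
  · obtain ⟨g, hg⟩ : toFractionAlgebra D G b ∣ toFractionAlgebra D G a := by
      refine (isWeaklyKrull_iff.1 hK).1 _ _ ((map_ne_zero_iff _ hinj).2 hb) fun Q hQ => ?_
      obtain ⟨s, hs, hd⟩ := hab _ (comap_mem_heightOneSpectrum hQ)
      refine ⟨toFractionAlgebra D G s, hs, ?_⟩
      rw [← map_mul]
      exact map_dvd _ hd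
    obtain ⟨d, f, hd, hdf⟩ := exists_mul_constHom_eq g
    have hC0 : constHom D G d ≠ 0 := (map_ne_zero_iff _ constHom_injective).2 hd
    have hadf : a * constHom D G d = b * f := hinj <| by
      rw [map_mul, map_mul, hg, mul_assoc, hdf]
    have hdvd : constHom D G d ∣ f := constHom_dvd_iff.2 fun x => by
      refine (isWeaklyKrull_iff.1 hD).1 _ _ hd fun P hP => ?_
      obtain ⟨s, hs, c, hc⟩ := hab _ (hUMT P hP)
      -- Cancelling `b` from `s a = b c` and `a d = b f` gives `s f = d c` with `s ∉ P[G]`.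
      obtain ⟨t, ht, htf⟩ := exists_constHom_dvd hP hd hs ⟨c, mul_left_cancel₀ hb (by
        linear_combination constHom D G d * hc - s * hadf : b * (s * f) = b * (constHom D G d * c))⟩
      exact ⟨t, ht, coeff_constHom_mul t f x ▸ constHom_dvd_iff.1 htf x⟩
    obtain ⟨f', rfl⟩ := hdvd
    exact ⟨f', mul_left_cancel₀ hC0 (by linear_combination hadf)⟩
  -- A single nonzero coefficient of `x` already bounds the primes `P[G]` over `x`; the image of `x`
  -- in `K[G]` bounds the contracted ones.
  · obtain ⟨y, hy⟩ := support_nonempty_of_ne_zero hx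
    have h1 := (hD.finite_of_ne_zero (Finsupp.mem_support_iff.1 hy)).image (coeffIdeal G)
    have h2 := (hK.finite_of_ne_zero ((map_ne_zero_iff _ hinj).2 hx)).image
      (Ideal.comap (toFractionAlgebra D G))
    refine (h1.union h2).subset ?_
    rintro A ⟨hA, hxA⟩
    rw [hU] at hA
    rcases hA with ⟨P, hP, rfl⟩ | ⟨Q, hQ, rfl⟩
    · exact Or.inl ⟨P, ⟨hP, hxA y⟩, rfl⟩
    · exact Or.inr ⟨Q, ⟨hQ, hxA⟩, rfl⟩

end WeaklyKrull

theorem proposition2p5 (D : Type*) [CommRing D] [IsDomain D] (G : Type*) [AddCommGroup G]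
    [IsAddTorsionFree G] (hG : ACCOnCyclicSubgroups G) :
    IsWeaklyKrull (AddMonoidAlgebra D G) ↔ IsWeaklyKrull D ∧ IsMonoidUMT D G := by
  have := uniqueFactorizationMonoid_groupAlgebra (FractionRing D) hG
  exact ⟨fun h => ⟨isWeaklyKrull_of_groupAlgebra h,
      isMonoidUMT_iff.2 fun _ => coeffIdeal_mem_heightOneSpectrum h⟩,
    fun h => isWeaklyKrull_groupAlgebra isWeaklyKrull_of_uniqueFactorizationMonoid h.1 h.2⟩
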